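/- All groups are finite and all characters are complex. For an irreducible character $\chi$ of a group $G$, let $\ker(\chi)=\{g\in G \mid \chi(g)=\chi(1)\}$ be its kernel and $Z(\chi)=\{g\in G \mid |\chi(g)|=\chi(1)\}$ its center; $\chi$ is said to have central type if $\chi(g)=0$ for every $g\in G\setminus Z(\chi)$. The group $G$ is called a GVZ-group if every irreducible character of $G$ has central type. For a normal subgroup $N$ of $G$, let $\mathrm{Irr}(G\mid N)$ denote the set of irreducible characters $\chi$ of $G$ with $N\not\le\ker(\chi)$. Theorem. Let $N$ be a nontrivial normal subgroup of a finite group $G$. If the order of $N$ is not a power of a prime and every character in $\mathrm{Irr}(G\mid N)$ has central type, then $G$ is a GVZ-group. -/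

import Mathlib

namespace PartialGVZ

/-- `χ : G → ℂ` is an irreducible (complex) character of `G`: the character of an irreducible
representation of `G` on some `ℂⁿ`. For a finite group `G` these functions form `Irr(G)`. -/
def IsIrrChar {G : Type*} [Group G] (χ : G → ℂ) : Prop :=
  ∃ (n : ℕ) (ρ : Representation ℂ G (Fin n → ℂ)), ρ.IsIrreducible ∧ ρ.character = χ

/-- The kernel `ker(χ) = {g | χ(g) = χ(1)}` of a character `χ`. -/
def charKer {G : Type*} [Group G] (χ : G → ℂ) : Set G :=
  {g | χ g = χ 1}

/-- The center `Z(χ) = {g | |χ(g)| = χ(1)}` of a character `χ`. -/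
def charCenter {G : Type*} [Group G] (χ : G → ℂ) : Set G :=
  {g | ((‖χ g‖ : ℝ) : ℂ) = χ 1}

/-- A character `χ` has central type if it vanishes on `G ∖ Z(χ)`. -/
def HasCentralType {G : Type*} [Group G] (χ : G → ℂ) : Prop :=
  ∀ g : G, g ∉ charCenter χ → χ g = 0

/-- The set `Irr(G | N)` of irreducible characters of `G` whose kernel does not contain `N`. -/
def irrOver {G : Type*} [Group G] (N : Subgroup G) : Set (G → ℂ) :=
  {χ | IsIrrChar χ ∧ ¬ (N : Set G) ⊆ charKer χ}

/-- `G` is a GVZ-group: every irreducible character of `G` has central type. -/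
def IsGVZGroup (G : Type*) [Group G] : Prop :=
  ∀ χ : G → ℂ, IsIrrChar χ → HasCentralType χ

end PartialGVZ

open scoped MonoidAlgebra

namespace PartialGVZ

/-! Write [g, G] for `commSubgroup g`, and call g flat if its class is the whole coset g[g, G]. At a
flat element every irreducible character has central type: g lies in Z(χ) exactly when [g, G] acts
trivially, and otherwise χ sums to zero over g[g, G], on which it is constant.

The hypothesis enters through Fourier analysis. The class defect of g is the uniform distribution on
its class minus the one on g[g, G]. Its Fourier transform vanishes at every character of central
type, hence on Irr(G | N), so the defect is constant on cosets of N. Therefore every element of N is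
flat (`isFlat_of_mem`), and so is every g not conjugate to gz for some z in N
(`isFlat_of_not_isConj_mul`).

Split |G| = ab with a the p-part, where p and another prime q divide |N|. Flatness inside N yields
nontrivial central elements z, w of N with z^a = 1 and w^b = 1. Multiplying an a-torsion element by
w, or a b-torsion element by z, leaves its class, so all such elements are flat. Then a-torsion and
b-torsion elements commute, and flatness passes to their products, which exhaust G. -/

/-! ### Irreducible representations and injectivity of the Fourier transform -/

theorem isIrreducible_iff {G V : Type*} [Group G] [AddCommGroup V] [Module ℂ V]
    (ρ : Representation ℂ G V) :
    ρ.IsIrreducible ↔ Nontrivial V ∧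
      ∀ W : Submodule ℂ V, (∀ g, ∀ v ∈ W, ρ g v ∈ W) → W = ⊥ ∨ W = ⊤ := by
  constructor
  · intro h
    refine ⟨?_, fun W hW => ?_⟩
    · by_contra hV
      rw [not_nontrivial_iff_subsingleton] at hV
      apply bot_ne_top (α := Subrepresentation ρ)
      apply Subrepresentation.toSubmodule_injective
      exact Subsingleton.elim _ _
    · rcases h.eq_bot_or_eq_top ⟨W, fun g v hv => hW g v hv⟩ with h | h
      · exact Or.inl (congrArg Subrepresentation.toSubmodule h)
      · exact Or.inr (congrArg Subrepresentation.toSubmodule h)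
  · rintro ⟨hV, h⟩
    exact
      { exists_pair_ne := ⟨⊥, ⊤, fun hbt =>
          bot_ne_top (α := Submodule ℂ V) (congrArg Subrepresentation.toSubmodule hbt)⟩
        eq_bot_or_eq_top := fun W => (h W.toSubmodule fun g v hv =>
            W.apply_mem_toSubmodule g hv).imp
          (fun e => Subrepresentation.toSubmodule_injective e)
          (fun e => Subrepresentation.toSubmodule_injective e) }

/-- Transport of a representation along a linear equivalence. -/
def transport {G V W : Type*} [Group G] [AddCommGroup V] [Module ℂ V] [AddCommGroup W]
    [Module ℂ W] (ρ : Representation ℂ G V) (e : V ≃ₗ[ℂ] W) : Representation ℂ G W where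
  toFun g := e.toLinearMap ∘ₗ ρ g ∘ₗ e.symm.toLinearMap
  map_one' := by ext; simp
  map_mul' x y := by ext; simp

theorem transport_apply {G V W : Type*} [Group G] [AddCommGroup V] [Module ℂ V] [AddCommGroup W]
    [Module ℂ W] (ρ : Representation ℂ G V) (e : V ≃ₗ[ℂ] W) (g : G) (w : W) :
    transport ρ e g w = e (ρ g (e.symm w)) := rfl

theorem transport_isIrreducible {G V W : Type*} [Group G] [AddCommGroup V] [Module ℂ V]
    [AddCommGroup W] [Module ℂ W] (ρ : Representation ℂ G V) (e : V ≃ₗ[ℂ] W)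
    (h : ρ.IsIrreducible) : (transport ρ e).IsIrreducible := by
  rw [isIrreducible_iff] at h ⊢
  obtain ⟨hV, h⟩ := h
  refine ⟨e.symm.toEquiv.nontrivial, fun U hU => ?_⟩
  have := h (U.comap e.toLinearMap) fun g v hv => by
    have := hU g (e v) hv
    rwa [transport_apply, e.symm_apply_apply] at this
  refine this.imp (fun hb => ?_) (fun ht => ?_)
  · rw [eq_bot_iff]
    intro u hu
    have : e.symm u ∈ U.comap e.toLinearMap := by simpa using hu
    rw [hb] at this
    simpa using this
  · rw [eq_top_iff]
    intro u _
    have : e.symm u ∈ U.comap e.toLinearMap := by rw [ht]; trivial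
    simpa using this

/-- The representation of `G` on a left ideal of its group algebra. -/
noncomputable def idealRep {G : Type*} [Group G] (S : Submodule ℂ[G] ℂ[G]) :
    Representation ℂ G S where
  toFun g :=
    { toFun := fun s => MonoidAlgebra.single g (1 : ℂ) • s
      map_add' := fun s t => smul_add _ s t
      map_smul' := fun c s => by
        ext1
        simp }
  map_one' := by
    ext1 s
    exact one_smul ℂ[G] s
  map_mul' x y := by
    ext1 s
    have : (MonoidAlgebra.single (x * y) (1 : ℂ)) =
      MonoidAlgebra.single x 1 * MonoidAlgebra.single y 1 := by simp
    change MonoidAlgebra.single (x * y) (1 : ℂ) • s = _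
    rw [this, mul_smul]
    rfl

theorem idealRep_apply {G : Type*} [Group G] (S : Submodule ℂ[G] ℂ[G]) (g : G) (s : S) :
    idealRep S g s = MonoidAlgebra.single g (1 : ℂ) • s := rfl

theorem idealRep_isIrreducible {G : Type*} [Group G] (S : Submodule ℂ[G] ℂ[G])
    [hS : IsSimpleModule ℂ[G] S] : (idealRep S).IsIrreducible := by
  rw [isIrreducible_iff]
  refine ⟨IsSimpleModule.nontrivial ℂ[G] S, fun W hW => ?_⟩
  let W' : Submodule ℂ[G] S :=
    { W with
      smul_mem' := fun c v hv => by
        induction c using MonoidAlgebra.induction_linear with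
        | zero => rw [zero_smul]; exact W.zero_mem
        | add x y hx hy => rw [add_smul]; exact W.add_mem hx hy
        | single g a =>
          have : MonoidAlgebra.single g a • v = a • (idealRep S g v) := by
            rw [idealRep_apply, ← smul_assoc, MonoidAlgebra.smul_single, smul_eq_mul, mul_one]
          rw [this]
          exact W.smul_mem a (hW g v hv) }
  have key : ∀ v, v ∈ W' ↔ v ∈ W := fun v => Iff.rfl
  rcases eq_bot_or_eq_top W' with h | h
  · left; ext v; rw [← key, h]; simp
  · right; ext v; rw [← key, h]; simp

/-- A function on a finite group whose Fourier transform vanishes is zero. -/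
theorem eq_zero_of_forall_irreducible {G : Type*} [Group G] [Fintype G] (a : G → ℂ)
    (h : ∀ (n : ℕ) (ρ : Representation ℂ G (Fin n → ℂ)), ρ.IsIrreducible →
      ∑ x, a x • ρ x = 0) : a = 0 := by
  classical
  let A : ℂ[G] := ∑ x, a x • MonoidAlgebra.single x (1 : ℂ)
  have hker : ∀ S : Submodule ℂ[G] ℂ[G], IsSimpleModule ℂ[G] S → ∀ s ∈ S, A * s = 0 := by
    intro S hS s hs
    have : FiniteDimensional ℂ S := by
      have : FiniteDimensional ℂ ℂ[G] := inferInstance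
      exact inferInstanceAs (FiniteDimensional ℂ (S.restrictScalars ℂ))
    let e := (Module.finBasis ℂ S).equivFun
    have h0 := h _ _ (transport_isIrreducible (idealRep S) e (idealRep_isIrreducible S))
    have h1 := LinearMap.congr_fun h0 (e ⟨s, hs⟩)
    simp only [LinearMap.sum_apply, LinearMap.smul_apply, transport_apply, e.symm_apply_apply,
      LinearMap.zero_apply, ← map_smul, ← map_sum] at h1
    rw [LinearEquiv.map_eq_zero_iff] at h1
    have h2 := congrArg (Subtype.val) h1
    simp only [A, Finset.sum_mul, smul_mul_assoc]
    simpa [idealRep_apply] using h2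
  -- By Maschke the group algebra is the sum of its simple left ideals, each of which `A` kills.
  have hA : ∀ s : ℂ[G], A * s = 0 := by
    intro s
    have hs : s ∈ sSup {m : Submodule ℂ[G] ℂ[G] | IsSimpleModule ℂ[G] m} := by
      rw [IsSemisimpleModule.sSup_simples_eq_top]; trivial
    rw [sSup_eq_iSup'] at hs
    induction hs using Submodule.iSup_induction' with
    | mem i x hx => exact hker i i.2 x hx
    | zero => simp
    | add x y _ _ hx hy => rw [mul_add, hx, hy, add_zero]
  have h1 := hA 1
  rw [mul_one] at h1
  funext y
  have := congrArg (fun F : ℂ[G] => F.coeff y) h1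
  simpa [A, MonoidAlgebra.coeff_sum, Finsupp.finsetSum_apply, Finsupp.single_apply] using this

/-! ### Scalar actions, centers and kernels of characters -/

/-- Complex numbers of norm at most one whose sum has real part equal to their number. -/
theorem re_eq_one_of_sum (s : Multiset ℂ) (h1 : ∀ z ∈ s, z.re ≤ 1)
    (hs : s.sum.re = Multiset.card s) : ∀ z ∈ s, z.re = 1 := by
  induction s using Multiset.induction_on with
  | empty => simp
  | cons a t ih =>
    have ht : t.sum.re ≤ Multiset.card t := by
      have := Multiset.sum_le_card_nsmul (t.map Complex.re) 1 (by
        intro x hx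
        obtain ⟨z, hz, rfl⟩ := Multiset.mem_map.1 hx
        exact h1 z (Multiset.mem_cons_of_mem hz))
      have e : (t.map Complex.re).sum = t.sum.re := (map_multiset_sum Complex.reAddGroupHom t).symm
      rw [e] at this
      simpa using this
    have ha := h1 a (Multiset.mem_cons_self a t)
    simp only [Multiset.sum_cons, Complex.add_re, Multiset.card_cons, Nat.cast_add,
      Nat.cast_one] at hs
    intro z hz
    rcases Multiset.mem_cons.1 hz with rfl | hz
    · linarith
    · exact ih (fun z hz => h1 z (Multiset.mem_cons_of_mem hz)) (by linarith) z hz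

/-- An endomorphism of finite order whose trace has maximal norm is a scalar. -/
theorem eq_scalar_of_norm_trace {V : Type*} [AddCommGroup V] [Module ℂ V] [FiniteDimensional ℂ V]
    (T : Module.End ℂ V) {m : ℕ} (hm : m ≠ 0) (hT : T ^ m = 1)
    (htr : ‖LinearMap.trace ℂ V T‖ = Module.finrank ℂ V) :
    ∃ c : ℂ, T = algebraMap ℂ _ c := by
  rcases subsingleton_or_nontrivial V with hV | hV
  · exact ⟨0, Subsingleton.elim _ _⟩
  set n := Module.finrank ℂ V with hn
  have hn0 : 0 < n := Module.finrank_pos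
  have hsplit : T.charpoly.Splits := IsAlgClosed.splits _
  have hsum := Module.End.trace_eq_sum_roots_charpoly_of_splits hsplit
  have hcard : Multiset.card T.charpoly.roots = n := by
    rw [← hsplit.natDegree_eq_card_roots, LinearMap.charpoly_natDegree]
  have hroot : ∀ z ∈ T.charpoly.roots, ‖z‖ = 1 := by
    intro z hz
    have hz' : T.HasEigenvalue z :=
      (Module.End.hasEigenvalue_iff_isRoot_charpoly T z).2 (Polynomial.isRoot_of_mem_roots hz)
    obtain ⟨v, hv⟩ := hz'.exists_hasEigenvector
    have h1 := hv.pow_apply m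
    rw [hT] at h1
    have h2 : (z ^ m - 1) • v = 0 := by rw [sub_smul, ← h1]; simp
    have h3 : z ^ m = 1 := sub_eq_zero.1 ((smul_eq_zero.1 h2).resolve_right hv.2)
    exact Complex.norm_eq_one_of_pow_eq_one h3 hm
  set t := LinearMap.trace ℂ V T with ht
  have htn : (n : ℂ) ≠ 0 := by exact_mod_cast hn0.ne'
  set c : ℂ := t / n with hc
  have hcn : ‖c‖ = 1 := by
    rw [hc, norm_div, htr]
    have : (n : ℝ) ≠ 0 := by exact_mod_cast hn0.ne'
    simp [this]
  have hcc : c * (starRingEnd ℂ) c = 1 := by rw [Complex.mul_conj, Complex.normSq_eq_norm_sq, hcn]; simp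
  -- `c` is the mean of the eigenvalues and has norm 1. Rotated by its conjugate, the `n`
  -- eigenvalues sum to `n`, the equality case of the triangle inequality.
  have key := re_eq_one_of_sum (T.charpoly.roots.map fun z => z * (starRingEnd ℂ) c)
    (by
      intro z hz
      obtain ⟨w, hw, rfl⟩ := Multiset.mem_map.1 hz
      refine (Complex.re_le_norm _).trans ?_
      rw [norm_mul, hroot w hw, RCLike.norm_conj, hcn, one_mul])
    (by
      rw [Multiset.sum_map_mul_right, Multiset.map_id', ← hsum, Multiset.card_map, hcard]
      have : t = c * n := by rw [hc]; field_simp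
      rw [this, mul_right_comm, hcc]; simp)
  have hall : ∀ z ∈ T.charpoly.roots, z = c := by
    intro z hz
    have h1 := key _ (Multiset.mem_map_of_mem _ hz)
    have h2 : ‖z * (starRingEnd ℂ) c‖ = 1 := by
      rw [norm_mul, hroot z hz, RCLike.norm_conj, hcn, one_mul]
    have h3 : z * (starRingEnd ℂ) c = 1 := by
      have h4 : Complex.normSq (z * (starRingEnd ℂ) c) = 1 := by
        rw [Complex.normSq_eq_norm_sq, h2]; norm_num
      rw [Complex.normSq_apply, h1] at h4
      apply Complex.ext
      · simpa using h1
      · have : (z * (starRingEnd ℂ) c).im * (z * (starRingEnd ℂ) c).im = 0 := by linarith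
        simpa using mul_self_eq_zero.1 this
    calc z = z * (c * (starRingEnd ℂ) c) := by rw [hcc, mul_one]
      _ = (z * (starRingEnd ℂ) c) * c := by ring
      _ = c := by rw [h3, one_mul]
  refine ⟨c, sub_eq_zero.1 ?_⟩
  -- `T - c` is nilpotent because `T` has the single eigenvalue `c`, and semisimple because `X ^ m -
  -- 1` is squarefree.
  apply Module.End.eq_zero_of_isNilpotent_isSemisimple
  · have hch : T.charpoly = (Polynomial.X - Polynomial.C c) ^ n := by
      conv_lhs => rw [hsplit.eq_prod_roots_of_monic T.charpoly_monic]
      rw [Multiset.eq_replicate.2 ⟨hcard, hall⟩, Multiset.map_replicate, Multiset.prod_replicate]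
    refine ⟨n, ?_⟩
    have := T.aeval_self_charpoly
    rw [hch] at this
    simpa using this
  · rw [Module.End.isSemisimple_sub_algebraMap_iff]
    apply Module.End.isSemisimple_of_squarefree_aeval_eq_zero
      (p := (Polynomial.X ^ m - 1 : Polynomial ℂ))
    · have := (Polynomial.separable_X_pow_sub_C (1 : ℂ) (n := m) (by exact_mod_cast hm) one_ne_zero)
      simpa using this.squarefree
    · simp [hT]

/-- Schur's lemma: an eigenspace of `T` is invariant, hence everything. -/
theorem exists_scalar_of_commute {G V : Type*} [Group G] [AddCommGroup V] [Module ℂ V]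
    [FiniteDimensional ℂ V] (ρ : Representation ℂ G V) (h : ρ.IsIrreducible)
    (T : Module.End ℂ V) (hT : ∀ g, T * ρ g = ρ g * T) : ∃ c : ℂ, T = algebraMap ℂ _ c := by
  rw [isIrreducible_iff] at h
  obtain ⟨hV, h⟩ := h
  obtain ⟨c, hc⟩ := Module.End.exists_eigenvalue T
  refine ⟨c, ?_⟩
  have htop : T.eigenspace c = ⊤ := by
    refine (h (T.eigenspace c) fun g v hv => ?_).resolve_left hc
    rw [Module.End.mem_eigenspace_iff] at hv ⊢
    have := LinearMap.congr_fun (hT g) v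
    simp only [Module.End.mul_apply] at this
    rw [this, hv, map_smul]
  ext v
  have : v ∈ T.eigenspace c := by rw [htop]; trivial
  rw [Module.End.mem_eigenspace_iff] at this
  simpa using this

/-- The sum over a normal subgroup vanishes in an irreducible representation in which the
subgroup acts nontrivially. -/
theorem sum_normal_eq_zero {G V : Type*} [Group G] [Fintype G] [AddCommGroup V] [Module ℂ V]
    (ρ : Representation ℂ G V) (h : ρ.IsIrreducible)
    (D : Subgroup G) [D.Normal] [Fintype D] (hD : ¬ ∀ d ∈ D, ρ d = 1) :
    ∑ d : D, ρ (d : G) = 0 := by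
  rw [isIrreducible_iff] at h
  obtain ⟨hV, h⟩ := h
  let W : Submodule ℂ V :=
    { carrier := {v | ∀ d ∈ D, ρ d v = v}
      add_mem' := fun ha hb d hd => by rw [map_add, ha d hd, hb d hd]
      zero_mem' := fun d _ => map_zero _
      smul_mem' := fun c v hv d hd => by rw [map_smul, hv d hd] }
  -- Normality of `D` makes its fixed space invariant under `G`.
  have hW : W = ⊥ := by
    refine (h W fun g v hv d hd => ?_).resolve_right fun ht => hD fun d hd => ?_
    · have h1 : d * g = g * (g⁻¹ * d * g) := by group
      have h2 : g⁻¹ * d * g ∈ D := by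
        simpa using (inferInstance : D.Normal).conj_mem d hd g⁻¹
      rw [← Module.End.mul_apply, ← map_mul, h1, map_mul, Module.End.mul_apply, hv _ h2]
    · ext v
      have : v ∈ W := by rw [ht]; trivial
      exact this d hd
  ext v
  have : (∑ d : D, ρ (d : G)) v ∈ W := fun e he => by
    rw [LinearMap.sum_apply, map_sum]
    refine Fintype.sum_equiv (Equiv.mulLeft (⟨e, he⟩ : D)) _ _ fun d => ?_
    rw [← Module.End.mul_apply, ← map_mul]
    rfl
  rw [hW] at this
  simpa using this

theorem apply_eq_scalar_of_mem_charCenter {G V : Type*} [Group G] [Finite G] [AddCommGroup V]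
    [Module ℂ V] [FiniteDimensional ℂ V] (ρ : Representation ℂ G V) {g : G}
    (hg : g ∈ charCenter ρ.character) : ∃ c : ℂ, ρ g = algebraMap ℂ _ c := by
  have h1 : ((‖ρ.character g‖ : ℝ) : ℂ) = ρ.character 1 := hg
  rw [Representation.char_one] at h1
  refine eq_scalar_of_norm_trace (ρ g) (orderOf_pos g).ne' ?_ (by exact_mod_cast h1)
  rw [← map_pow, pow_orderOf_eq_one, map_one]

theorem mem_charCenter_of_apply_eq_scalar {G V : Type*} [Group G] [Finite G] [AddCommGroup V]
    [Module ℂ V] [FiniteDimensional ℂ V] [Nontrivial V] (ρ : Representation ℂ G V) {g : G} {c : ℂ}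
    (hc : ρ g = algebraMap ℂ _ c) : g ∈ charCenter ρ.character := by
  have h1 : c ^ orderOf g = 1 := by
    apply (algebraMap ℂ (Module.End ℂ V)).injective
    rw [map_pow, ← hc, ← map_pow, pow_orderOf_eq_one, map_one, map_one]
  have h2 : ‖c‖ = 1 := Complex.norm_eq_one_of_pow_eq_one h1 (orderOf_pos g).ne'
  change ((‖ρ.character g‖ : ℝ) : ℂ) = ρ.character 1
  rw [Representation.char_one, Representation.character, hc, Algebra.algebraMap_eq_smul_one,
    map_smul, LinearMap.trace_one, norm_smul, h2]
  simp

theorem apply_eq_one_of_mem_charKer {G V : Type*} [Group G] [Finite G] [AddCommGroup V]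
    [Module ℂ V] [FiniteDimensional ℂ V] [Nontrivial V] (ρ : Representation ℂ G V) {g : G}
    (hg : g ∈ charKer ρ.character) : ρ g = 1 := by
  have h1 : ρ.character g = ρ.character 1 := hg
  obtain ⟨c, hc⟩ := apply_eq_scalar_of_mem_charCenter ρ (g := g) (by
    change ((‖ρ.character g‖ : ℝ) : ℂ) = ρ.character 1
    rw [h1, Representation.char_one]; simp)
  rw [Representation.char_one, Representation.character, hc, Algebra.algebraMap_eq_smul_one,
    map_smul, LinearMap.trace_one, smul_eq_mul] at h1
  have h2 : (Module.finrank ℂ V : ℂ) ≠ 0 := by exact_mod_cast Module.finrank_pos.ne'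
  have h3 : c = 1 := mul_right_cancel₀ h2 (by rw [h1, one_mul])
  rw [hc, h3, map_one]

/-! ### Flat elements -/

/-- The normal subgroup `[g, G]` generated by the commutators of `g`. -/
def commSubgroup {G : Type*} [Group G] (g : G) : Subgroup G :=
  Subgroup.normalClosure (Set.range fun x => g⁻¹ * (x * g * x⁻¹))

instance {G : Type*} [Group G] (g : G) : (commSubgroup g).Normal :=
  Subgroup.normalClosure_normal

/-- The conjugacy class of `g` is the full coset `g[g, G]`. -/
def IsFlat {G : Type*} [Group G] (g : G) : Prop :=
  ∀ d ∈ commSubgroup g, IsConj g (g * d)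

theorem conj_mem_commSubgroup {G : Type*} [Group G] (g x : G) :
    g⁻¹ * (x * g * x⁻¹) ∈ commSubgroup g :=
  Subgroup.subset_normalClosure ⟨x, rfl⟩

theorem commSubgroup_le {G : Type*} [Group G] {g : G} {M : Subgroup G} [M.Normal]
    (h : ∀ x, g⁻¹ * (x * g * x⁻¹) ∈ M) : commSubgroup g ≤ M :=
  Subgroup.normalClosure_le_normal (by rintro _ ⟨x, rfl⟩; exact h x)

theorem commSubgroup_le_of_mem {G : Type*} [Group G] {g : G} {M : Subgroup G} [hM : M.Normal]
    (h : g ∈ M) : commSubgroup g ≤ M :=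
  commSubgroup_le fun x => M.mul_mem (M.inv_mem h) (hM.conj_mem g h x)

/-- By Schur, `ρ g` is scalar exactly when it commutes with all `ρ x`, that is, when `ρ` kills the
commutators of `g`. -/
theorem apply_eq_scalar_iff {G V : Type*} [Group G] [AddCommGroup V] [Module ℂ V]
    [FiniteDimensional ℂ V] (ρ : Representation ℂ G V) (h : ρ.IsIrreducible) (g : G) :
    (∃ c : ℂ, ρ g = algebraMap ℂ _ c) ↔ ∀ d ∈ commSubgroup g, ρ d = 1 := by
  constructor
  · rintro ⟨c, hc⟩
    have : commSubgroup g ≤ MonoidHom.ker ρ := commSubgroup_le fun x => by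
      rw [MonoidHom.mem_ker, map_mul, map_mul, map_mul, hc, ← Algebra.commutes c (ρ x), mul_assoc,
        ← map_mul ρ, mul_inv_cancel, map_one, mul_one, ← hc, ← map_mul, inv_mul_cancel, map_one]
    exact fun d hd => this hd
  · intro hd
    refine exists_scalar_of_commute ρ h _ fun x => ?_
    have h1 := hd _ (conj_mem_commSubgroup g x)
    have h2 : x * g = g * (g⁻¹ * (x * g * x⁻¹)) * x := by group
    rw [← map_mul, ← map_mul, h2, map_mul ρ (_ * _) x, map_mul ρ g (_ * _), h1, mul_one,
      map_mul]

/-- The irreducible characters are of central type at flat elements. -/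
theorem char_eq_zero_of_isFlat {G : Type*} [Group G] [Finite G] {g : G} (hg : IsFlat g)
    {χ : G → ℂ} (hχ : IsIrrChar χ) (hgχ : g ∉ charCenter χ) : χ g = 0 := by
  classical
  have := Fintype.ofFinite G
  obtain ⟨n, ρ, hρ, rfl⟩ := hχ
  have hV := ((isIrreducible_iff ρ).1 hρ).1
  have h1 : ¬ ∀ d ∈ commSubgroup g, ρ d = 1 := fun h => by
    obtain ⟨c, hc⟩ := (apply_eq_scalar_iff ρ hρ g).2 h
    exact hgχ (mem_charCenter_of_apply_eq_scalar ρ hc)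
  have h2 := sum_normal_eq_zero ρ hρ (commSubgroup g) h1
  have h3 : ∑ d : commSubgroup g, ρ.character (g * d) = 0 := by
    simp only [Representation.character]
    rw [← map_sum]
    simp only [map_mul]
    rw [← Finset.mul_sum, h2, mul_zero, map_zero]
  have h4 : ∀ d : commSubgroup g, ρ.character (g * d) = ρ.character g := fun d => by
    obtain ⟨x, hx⟩ := isConj_iff.1 (hg d d.2)
    rw [← hx, Representation.char_conj]
  simp only [h4, Finset.sum_const, nsmul_eq_mul] at h3
  refine (mul_eq_zero.1 h3).resolve_left ?_
  exact_mod_cast (Finset.card_ne_zero.2 ⟨1, Finset.mem_univ _⟩)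

/-! ### Class defects and their invariance under N -/

open Classical in
/-- The uniform distribution on the conjugacy class of `g` minus that on `g[g, G]`. -/
noncomputable def classDefect {G : Type*} [Group G] [Fintype G] (g y : G) : ℂ :=
  (∑ x : G, if x * g * x⁻¹ = y then (Fintype.card G : ℂ)⁻¹ else 0) -
    ∑ d : commSubgroup g, if g * d = y then (Nat.card (commSubgroup g) : ℂ)⁻¹ else 0

theorem sum_classDefect {G V : Type*} [Group G] [Fintype G] [AddCommGroup V] [Module ℂ V]
    (g : G) (F : G → V) [Fintype (commSubgroup g)] :
    ∑ y, classDefect g y • F y = (Fintype.card G : ℂ)⁻¹ • ∑ x : G, F (x * g * x⁻¹) -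
      (Nat.card (commSubgroup g) : ℂ)⁻¹ • ∑ d : commSubgroup g, F (g * d) := by
  classical
  simp only [classDefect, sub_smul, Finset.sum_sub_distrib, Finset.sum_smul]
  rw [Finset.sum_comm]
  conv_lhs => enter [2]; rw [Finset.sum_comm]
  simp only [ite_smul, zero_smul, Finset.sum_ite_eq, Finset.mem_univ, if_true, Finset.smul_sum]
  congr!

/-- If `[g, G]` acts trivially, both averages equal `ρ g`. Otherwise both vanish: the coset average
by `sum_normal_eq_zero`, the class average because it is a scalar of trace zero. -/
theorem sum_classDefect_smul_eq_zero {G V : Type*} [Group G] [Fintype G] [AddCommGroup V]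
    [Module ℂ V] [FiniteDimensional ℂ V] (ρ : Representation ℂ G V) (hρ : ρ.IsIrreducible) (g : G)
    (hg : g ∉ charCenter ρ.character → ρ.character g = 0) :
    ∑ y, classDefect g y • ρ y = 0 := by
  classical
  have hV := ((isIrreducible_iff ρ).1 hρ).1
  have hG : (Fintype.card G : ℂ) ≠ 0 := by exact_mod_cast Fintype.card_ne_zero
  have hD : (Nat.card (commSubgroup g) : ℂ) ≠ 0 := by exact_mod_cast Nat.card_pos.ne'
  rw [sum_classDefect]
  by_cases h : ∀ d ∈ commSubgroup g, ρ d = 1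
  · have h1 : ∀ x, ρ (x * g * x⁻¹) = ρ g := fun x => by
      have h1 := h _ (conj_mem_commSubgroup g x)
      have h2 : x * g * x⁻¹ = g * (g⁻¹ * (x * g * x⁻¹)) := by group
      rw [h2, map_mul, h1, mul_one]
    have h2 : ∀ d : commSubgroup g, ρ (g * d) = ρ g := fun d => by
      rw [map_mul, h d d.2, mul_one]
    simp only [h1, h2, Finset.sum_const, Finset.card_univ, ← Nat.card_eq_fintype_card (α := commSubgroup g), ← Nat.cast_smul_eq_nsmul ℂ, smul_smul,
      inv_mul_cancel₀ hG, inv_mul_cancel₀ hD, sub_self]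
  · have h0 : ρ.character g = 0 := hg fun hc =>
      h ((apply_eq_scalar_iff ρ hρ g).1 (apply_eq_scalar_of_mem_charCenter ρ hc))
    have h1 : ∑ d : commSubgroup g, ρ (g * d) = 0 := by
      simp only [map_mul]
      rw [← Finset.mul_sum, sum_normal_eq_zero ρ hρ _ h, mul_zero]
    have h2 : ∑ x : G, ρ (x * g * x⁻¹) = 0 := by
      obtain ⟨c, hc⟩ := exists_scalar_of_commute ρ hρ (∑ x : G, ρ (x * g * x⁻¹)) fun y => by
        rw [Finset.sum_mul, Finset.mul_sum]
        refine Fintype.sum_equiv (Equiv.mulLeft y⁻¹) _ _ fun x => ?_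
        rw [← map_mul, ← map_mul]
        congr 1
        simp [mul_assoc]
      have h3 := congrArg (LinearMap.trace ℂ V) hc
      have h4 : ∀ x, LinearMap.trace ℂ V (ρ (x * g * x⁻¹)) = 0 := fun x =>
        (Representation.char_conj ρ g x).trans h0
      rw [map_sum, Finset.sum_eq_zero fun x _ => h4 x, Algebra.algebraMap_eq_smul_one,
        map_smul, LinearMap.trace_one, smul_eq_mul] at h3
      have h5 : (Module.finrank ℂ V : ℂ) ≠ 0 := by exact_mod_cast Module.finrank_pos.ne'
      have h6 : c = 0 := (mul_eq_zero.1 h3.symm).resolve_right h5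
      rw [hc, h6, map_zero]
    rw [h1, h2, smul_zero, smul_zero, sub_zero]

/-- Right translation of `f` by `n` multiplies its Fourier transform by `ρ n⁻¹`. -/
theorem sum_translate_sub_smul {G V : Type*} [Group G] [Fintype G] [AddCommGroup V] [Module ℂ V]
    (ρ : Representation ℂ G V) (f : G → ℂ) {n : G}
    (h : ρ n = 1 ∨ ∑ y, f y • ρ y = 0) : ∑ y, (f (y * n) - f y) • ρ y = 0 := by
  simp only [sub_smul, Finset.sum_sub_distrib]
  have h1 : ∑ y, f (y * n) • ρ y = (∑ y, f y • ρ y) * ρ n⁻¹ := by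
    rw [Finset.sum_mul]
    refine Fintype.sum_equiv (Equiv.mulRight n) _ _ fun y => ?_
    rw [smul_mul_assoc, ← map_mul]
    simp
  rw [h1]
  rcases h with h | h
  · have h2 : ρ n * ρ n⁻¹ = 1 := by rw [← map_mul, mul_inv_cancel, map_one]
    rw [h, one_mul] at h2
    rw [h2, mul_one, sub_self]
  · rw [h, zero_mul, sub_zero]

/-- If all characters in `Irr(G | N)` have central type, the class defects are constant on the
cosets of `N`. -/
theorem classDefect_mul_right {G : Type*} [Group G] [Fintype G] {N : Subgroup G}
    (h : ∀ χ ∈ irrOver N, HasCentralType χ) (g y : G) {n : G} (hn : n ∈ N) :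
    classDefect g (y * n) = classDefect g y := by
  have h0 : (fun y => classDefect g (y * n) - classDefect g y) = 0 := by
    refine eq_zero_of_forall_irreducible _ fun k ρ hρ => ?_
    have hV := ((isIrreducible_iff ρ).1 hρ).1
    refine sum_translate_sub_smul ρ (classDefect g) (or_iff_not_imp_left.2 fun hρn => ?_)
    exact sum_classDefect_smul_eq_zero ρ hρ g
      (h _ ⟨⟨k, ρ, hρ, rfl⟩, fun hN => hρn (apply_eq_one_of_mem_charKer ρ (hN hn))⟩ g)
  exact sub_eq_zero.1 (congrFun h0 y)

theorem classDefect_eq_zero {G : Type*} [Group G] [Fintype G] {g y : G}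
    (h : g⁻¹ * y ∉ commSubgroup g) : classDefect g y = 0 := by
  classical
  rw [classDefect, Finset.sum_eq_zero, Finset.sum_eq_zero, sub_zero]
  · rintro d -
    rw [if_neg]
    rintro rfl
    exact h (by simp)
  · rintro x -
    rw [if_neg]
    rintro rfl
    exact h (conj_mem_commSubgroup g x)

theorem classDefect_of_not_isConj {G : Type*} [Group G] [Fintype G] {g y : G}
    (h : g⁻¹ * y ∈ commSubgroup g) (hy : ¬ IsConj g y) :
    classDefect g y = -(Nat.card (commSubgroup g) : ℂ)⁻¹ := by
  classical
  rw [classDefect, Finset.sum_eq_zero, zero_sub,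
    Finset.sum_eq_single (⟨g⁻¹ * y, h⟩ : commSubgroup g)]
  · simp
  · rintro d - hd
    rw [if_neg]
    rintro rfl
    exact hd (Subtype.ext (by simp))
  · exact fun h => absurd (Finset.mem_univ _) h
  · rintro x -
    rw [if_neg]
    rintro rfl
    exact hy (isConj_iff.2 ⟨x, rfl⟩)

/-- The class of `g` has positive mass at `g`, since `x = 1` contributes. -/
theorem classDefect_self_ne {G : Type*} [Group G] [Fintype G] (g : G) :
    classDefect g g ≠ -(Nat.card (commSubgroup g) : ℂ)⁻¹ := by
  classical
  have hG : (Fintype.card G : ℂ) ≠ 0 := by exact_mod_cast Fintype.card_ne_zero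
  rw [classDefect, Finset.sum_eq_single (1 : commSubgroup g), sub_eq_add_neg]
  · rw [Finset.sum_ite, Finset.sum_const_zero, add_zero, Finset.sum_const, nsmul_eq_mul]
    simp only [OneMemClass.coe_one, mul_one, if_true, ne_eq, add_eq_right, mul_eq_zero,
      inv_eq_zero, hG, or_false, Nat.cast_eq_zero, Finset.card_eq_zero]
    exact Finset.ne_empty_of_mem (a := 1) (by simp)
  · rintro d - hd
    rw [if_neg]
    intro h
    exact hd (Subtype.ext (by simpa using h))
  · exact fun h => absurd (Finset.mem_univ _) h

/-- The defect of `g` is constant on `N`, which contains `g[g, G]`, so it cannot distinguish a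
missing conjugate from `g` itself. -/
theorem isFlat_of_mem {G : Type*} [Group G] [Finite G] {N : Subgroup G} [N.Normal]
    (h : ∀ χ ∈ irrOver N, HasCentralType χ) {g : G} (hg : g ∈ N) : IsFlat g := by
  classical
  have := Fintype.ofFinite G
  have hconst : ∀ y ∈ N, classDefect g y = classDefect g g := fun y hy => by
    have := classDefect_mul_right h g g (n := g⁻¹ * y) (N.mul_mem (N.inv_mem hg) hy)
    simpa using this
  intro d hd
  by_contra hcon
  have hdN : d ∈ N := commSubgroup_le_of_mem hg hd
  have h1 := classDefect_of_not_isConj (g := g) (y := g * d) (by simpa using hd) hcon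
  rw [hconst _ (N.mul_mem hg hdN)] at h1
  exact classDefect_self_ne g h1

/-- If `z` lies in `[g, G]`, the defect would differ at `g` and `gz`. If not, translation by `z`
moves `g[g, G]` off itself, where the defect is zero, so no point of the coset can be missing from
the class. -/
theorem isFlat_of_not_isConj_mul {G : Type*} [Group G] [Finite G] {N : Subgroup G}
    (h : ∀ χ ∈ irrOver N, HasCentralType χ) {g z : G} (hz : z ∈ N)
    (hgz : ¬ IsConj g (g * z)) : IsFlat g := by
  classical
  have := Fintype.ofFinite G
  by_cases hzD : z ∈ commSubgroup g
  · have h1 := classDefect_of_not_isConj (g := g) (y := g * z) (by simpa using hzD) hgz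
    rw [classDefect_mul_right h g g hz] at h1
    exact absurd h1 (classDefect_self_ne g)
  · intro d hd
    by_contra hcon
    have h1 := classDefect_of_not_isConj (g := g) (y := g * d) (by simpa using hd) hcon
    rw [← classDefect_mul_right h g _ hz, classDefect_eq_zero] at h1
    · have hD : (Nat.card (commSubgroup g) : ℂ) ≠ 0 := by exact_mod_cast Nat.card_pos.ne'
      exact neg_ne_zero.2 (inv_ne_zero hD) h1.symm
    · intro h2
      have : z = d⁻¹ * (g⁻¹ * (g * d * z)) := by group
      exact hzD (this ▸ (commSubgroup g).mul_mem ((commSubgroup g).inv_mem hd) h2)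

/-! ### Coprime torsion and flatness -/

theorem eq_one_of_coprime_pow {G : Type*} [Group G] {x : G} {a b : ℕ} (hab : a.Coprime b)
    (ha : x ^ a = 1) (hb : x ^ b = 1) : x = 1 := by
  have h := Nat.dvd_gcd (orderOf_dvd_of_pow_eq_one ha) (orderOf_dvd_of_pow_eq_one hb)
  rw [hab.gcd_eq_one] at h
  exact orderOf_eq_one_iff.1 (Nat.dvd_one.1 h)

/-- If `x ^ (a * b) = 1` for coprime `a` and `b`, then `x` is the product of two commuting powers
of orders dividing `a` and `b`. -/
theorem exists_coprime_decomposition {G : Type*} [Group G] {a b : ℕ} (hab : a.Coprime b) (x : G)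
    (hx : x ^ (a * b) = 1) :
    ∃ u ∈ Subgroup.zpowers x, ∃ v ∈ Subgroup.zpowers x, u ^ a = 1 ∧ v ^ b = 1 ∧ x = u * v := by
  have hx' : x ^ ((a : ℤ) * b) = 1 := by exact_mod_cast hx
  refine ⟨x ^ ((b : ℤ) * a.gcdB b), ⟨_, rfl⟩, x ^ ((a : ℤ) * a.gcdA b), ⟨_, rfl⟩, ?_, ?_, ?_⟩
  · rw [← zpow_natCast, ← zpow_mul, show (b : ℤ) * a.gcdB b * a = (a : ℤ) * b * a.gcdB b by ring,
      zpow_mul, hx', one_zpow]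
  · rw [← zpow_natCast, ← zpow_mul, show (a : ℤ) * a.gcdA b * b = (a : ℤ) * b * a.gcdA b by ring,
      zpow_mul, hx', one_zpow]
  · have h := Nat.gcd_eq_gcd_ab a b
    rw [hab.gcd_eq_one] at h
    rw [← zpow_add, add_comm, ← h]
    simp

theorem pow_eq_one_of_isConj {G : Type*} [Group G] {x y : G} {a : ℕ} (h : IsConj x y)
    (hx : x ^ a = 1) : y ^ a = 1 := by
  obtain ⟨c, rfl⟩ := isConj_iff.1 h
  rw [conj_pow, hx, mul_one, mul_inv_cancel]

theorem pow_eq_one_of_isConj_mul {G : Type*} [Group G] {x w : G} {a : ℕ} (hw : Commute x w)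
    (h : IsConj x (x * w)) (hx : x ^ a = 1) : w ^ a = 1 := by
  have := pow_eq_one_of_isConj h hx
  rwa [hw.mul_pow, hx, one_mul] at this

theorem commSubgroup_eq_bot_iff {G : Type*} [Group G] {g : G} :
    commSubgroup g = ⊥ ↔ ∀ x, Commute g x := by
  constructor
  · intro h x
    have := conj_mem_commSubgroup g x
    rw [h, Subgroup.mem_bot, inv_mul_eq_one, eq_mul_inv_iff_mul_eq] at this
    exact this
  · intro h
    rw [eq_bot_iff]
    refine commSubgroup_le fun x => ?_
    rw [Subgroup.mem_bot, inv_mul_eq_one, eq_mul_inv_iff_mul_eq]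
    exact h x

theorem IsFlat.not_mem_commSubgroup {G : Type*} [Group G] {g : G} (h : IsFlat g) (hg : g ≠ 1) :
    g ∉ commSubgroup g := by
  intro hmem
  have := h g⁻¹ (inv_mem hmem)
  rw [mul_inv_cancel] at this
  exact hg (isConj_one_left.1 this)

/-- This strict descent drives the minimal choices that produce central elements. -/
theorem IsFlat.commSubgroup_lt {G : Type*} [Group G] {g : G} (h : IsFlat g) (hg : g ≠ 1)
    {M : Subgroup G} [M.Normal] (hM : g ∈ M) : commSubgroup g < M :=
  lt_of_le_of_ne (commSubgroup_le_of_mem hM) fun e => h.not_mem_commSubgroup hg (e ▸ hM)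

/-- Let `Nat.card G = a * b` with `a` and `b` coprime. If the `a`-torsion and `b`-torsion elements
of a normal subgroup `M` are flat and `M` contains a nontrivial `a`-torsion element, then it
contains a central one. -/
theorem exists_central_pow_eq_one {G : Type*} [Group G] [Finite G] {a b : ℕ} (hab : a.Coprime b)
    (hcard : a * b = Nat.card G) {M : Subgroup G} [M.Normal]
    (hA : ∀ x ∈ M, x ^ a = 1 → IsFlat x) (hB : ∀ x ∈ M, x ^ b = 1 → IsFlat x)
    (hM : ∃ x ∈ M, x ≠ 1 ∧ x ^ a = 1) :
    ∃ z ∈ M, z ≠ 1 ∧ z ^ a = 1 ∧ ∀ x, Commute z x := by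
  -- Take `[g, G]` minimal. A nontrivial `a`-torsion element in it would give a smaller one, so `[g,
  -- G]` is `b`-torsion.
  obtain ⟨g, ⟨hg, hg1, hga⟩, hmin⟩ :=
    (InvImage.wf (commSubgroup (G := G)) wellFounded_lt).has_min
      {x | x ∈ M ∧ x ≠ 1 ∧ x ^ a = 1} hM
  refine ⟨g, hg, hg1, hga, commSubgroup_eq_bot_iff.1 ?_⟩
  have hle : commSubgroup g ≤ M := commSubgroup_le_of_mem hg
  have hnoA : ∀ x ∈ commSubgroup g, x ^ a = 1 → x = 1 := fun x hx hxa => by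
    by_contra hx1
    exact hmin x ⟨hle hx, hx1, hxa⟩
      ((hA x (hle hx) hxa).commSubgroup_lt hx1 hx)
  have hDB : ∀ x ∈ commSubgroup g, x ^ b = 1 := fun x hx => by
    obtain ⟨u, hu, v, -, hua, hvb, rfl⟩ := exists_coprime_decomposition hab x
      (by rw [hcard, pow_card_eq_one'])
    rw [hnoA u ((Subgroup.zpowers_le.2 hx) hu) hua, one_mul, hvb]
  by_contra hne
  obtain ⟨y, hy, hy1⟩ := (commSubgroup g).bot_or_exists_ne_one.resolve_left hne
  -- The same descent inside `[g, G]` gives a central `w ≠ 1`. Flatness makes `g` and `g * w`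
  -- conjugate, so `w ^ a = 1`, which is impossible.
  obtain ⟨w, ⟨hw, hw1⟩, hwmin⟩ :=
    (InvImage.wf (commSubgroup (G := G)) wellFounded_lt).has_min
      {x | x ∈ commSubgroup g ∧ x ≠ 1} ⟨y, hy, hy1⟩
  have hwc : commSubgroup w = ⊥ := by
    rw [eq_bot_iff]
    intro x hx
    by_contra hx1
    have hxg : x ∈ commSubgroup g := commSubgroup_le_of_mem hw hx
    exact hwmin x ⟨hxg, hx1⟩
      ((hB x (hle hxg) (hDB x hxg)).commSubgroup_lt hx1 hx)
  exact hw1 (hnoA w hw (pow_eq_one_of_isConj_mul (commSubgroup_eq_bot_iff.1 hwc g).symm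
    (hA g hg hga w hw) hga))

/-- If all `a`-torsion and `b`-torsion elements are flat, then `[g, G]` is a `b`-torsion group for
each `b`-torsion element `g`. -/
theorem pow_eq_one_of_mem_commSubgroup {G : Type*} [Group G] [Finite G] {a b : ℕ}
    (hab : a.Coprime b) (hcard : a * b = Nat.card G)
    (hA : ∀ x : G, x ^ a = 1 → IsFlat x) (hB : ∀ x : G, x ^ b = 1 → IsFlat x)
    {g : G} (hg : g ^ b = 1) {x : G} (hx : x ∈ commSubgroup g) : x ^ b = 1 := by
  -- Otherwise `[g, G]` contains a central `a`-torsion `z ≠ 1`; `g` is conjugate to `g * z`, which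
  -- forces `z ^ b = 1`.
  have hno : ∀ u ∈ commSubgroup g, u ^ a = 1 → u = 1 := fun u hu hua => by
    by_contra hu1
    obtain ⟨z, hz, hz1, hza, hzc⟩ := exists_central_pow_eq_one hab hcard
      (M := commSubgroup g) (fun x _ => hA x) (fun x _ => hB x) ⟨u, hu, hu1, hua⟩
    exact hz1 (eq_one_of_coprime_pow hab hza
      (pow_eq_one_of_isConj_mul (hzc g).symm (hB g hg z hz) hg))
  obtain ⟨u, hu, v, -, hua, hvb, rfl⟩ := exists_coprime_decomposition hab x
    (by rw [hcard, pow_card_eq_one'])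
  rw [hno u ((Subgroup.zpowers_le.2 hx) hu) hua, one_mul, hvb]

/-- The commutator of `x` and `y` lies in both `[x, G]` and `[y, G]`, whose torsion is coprime. -/
theorem commute_of_forall_isFlat {G : Type*} [Group G] [Finite G] {a b : ℕ}
    (hab : a.Coprime b) (hcard : a * b = Nat.card G)
    (hA : ∀ x : G, x ^ a = 1 → IsFlat x) (hB : ∀ x : G, x ^ b = 1 → IsFlat x)
    {x y : G} (hx : x ^ a = 1) (hy : y ^ b = 1) : Commute x y := by
  have h1 : x⁻¹ * (y * x * y⁻¹) ∈ commSubgroup x := conj_mem_commSubgroup x y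
  have h2 : x⁻¹ * (y * x * y⁻¹) ∈ commSubgroup y := by
    have h3 := (inferInstance : (commSubgroup y).Normal).conj_mem _
      (conj_mem_commSubgroup y x⁻¹) y
    convert h3 using 1
    group
  have h4 := eq_one_of_coprime_pow hab
    (pow_eq_one_of_mem_commSubgroup hab.symm (by rw [mul_comm, hcard]) hB hA hx h1)
    (pow_eq_one_of_mem_commSubgroup hab hcard hA hB hy h2)
  rw [inv_mul_eq_one, eq_mul_inv_iff_mul_eq] at h4
  exact h4

theorem isFlat_of_forall_isFlat {G : Type*} [Group G] [Finite G] {a b : ℕ}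
    (hab : a.Coprime b) (hcard : a * b = Nat.card G)
    (hA : ∀ x : G, x ^ a = 1 → IsFlat x) (hB : ∀ x : G, x ^ b = 1 → IsFlat x) (g : G) :
    IsFlat g := by
  have hcomm : ∀ {x y : G}, x ^ a = 1 → y ^ b = 1 → Commute x y :=
    fun hx hy => commute_of_forall_isFlat hab hcard hA hB hx hy
  have hdec := fun x : G => exists_coprime_decomposition hab x (by rw [hcard, pow_card_eq_one'])
  obtain ⟨u, -, v, -, hu, hv, rfl⟩ := hdec g
  have hle : commSubgroup (u * v) ≤ commSubgroup u ⊔ commSubgroup v := commSubgroup_le fun x => by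
    have h1 := (inferInstance : (commSubgroup u).Normal).conj_mem _ (conj_mem_commSubgroup u x) v⁻¹
    have h2 := Subgroup.mul_mem_sup h1 (conj_mem_commSubgroup v x)
    convert h2 using 1
    group
  intro d hd
  obtain ⟨d₁, hd₁, d₂, hd₂, rfl⟩ := Subgroup.mem_sup_of_normal_left.1 (hle hd)
  have hd₁a : d₁ ^ a = 1 :=
    pow_eq_one_of_mem_commSubgroup hab.symm (by rw [mul_comm, hcard]) hB hA hu hd₁
  obtain ⟨x, hx⟩ := isConj_iff.1 (hA u hu d₁ hd₁)
  obtain ⟨y, hy⟩ := isConj_iff.1 (hB v hv d₂ hd₂)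
  -- Only the `a`-part of `x` acts on `u` and only the `b`-part of `y` acts on `v`, so `x₁ * y₂`
  -- performs both conjugations at once.
  obtain ⟨x₁, -, x₂, -, hx₁, hx₂, rfl⟩ := hdec x
  obtain ⟨y₁, -, y₂, -, hy₁, hy₂, rfl⟩ := hdec y
  have e1 : x₁ * u * x₁⁻¹ = u * d₁ := by
    rw [← hx, mul_inv_rev, mul_assoc x₁ x₂ u, ← (hcomm hu hx₂).eq]
    group
  have e2 : y₂ * v * y₂⁻¹ = v * d₂ := by
    have hc : Commute y₁ (y₂ * v * y₂⁻¹) := hcomm hy₁ (by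
      rw [conj_pow, hv, mul_one, mul_inv_cancel])
    calc y₂ * v * y₂⁻¹ = y₁ * (y₂ * v * y₂⁻¹) * y₁⁻¹ := by rw [hc.eq, mul_inv_cancel_right]
      _ = v * d₂ := by rw [← hy]; group
  refine isConj_iff.2 ⟨x₁ * y₂, ?_⟩
  have c1 : y₂ * u = u * y₂ := (hcomm hu hy₂).eq.symm
  have c2 : Commute x₁ (y₂ * v * y₂⁻¹) := hcomm hx₁ (by
      rw [conj_pow, hv, mul_one, mul_inv_cancel])
  calc x₁ * y₂ * (u * v) * (x₁ * y₂)⁻¹ = x₁ * (y₂ * u) * v * y₂⁻¹ * x₁⁻¹ := by group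
    _ = x₁ * u * ((y₂ * v * y₂⁻¹) * x₁⁻¹) := by rw [c1]; group
    _ = (x₁ * u * x₁⁻¹) * (y₂ * v * y₂⁻¹) := by rw [← (c2.inv_left).eq]; group
    _ = u * (d₁ * v) * d₂ := by rw [e1, e2]; group
    _ = u * v * (d₁ * d₂) := by rw [(hcomm hd₁a hv).eq]; group

end PartialGVZ

/-! ### The theorem -/

theorem theoremB {G : Type*} [Group G] [Finite G] (N : Subgroup G) [N.Normal]
    (hN : N ≠ ⊥) (hpp : ¬ IsPrimePow (Nat.card N))
    (h : ∀ χ ∈ PartialGVZ.irrOver N, PartialGVZ.HasCentralType χ) :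
    PartialGVZ.IsGVZGroup G := by
  open PartialGVZ in
  -- `IsPrimePow` excludes 1, so the trivial subgroup is ruled out separately.
  have hN1 : Nat.card N ≠ 1 := fun h1 => hN (Subgroup.card_eq_one.1 h1)
  obtain ⟨p, hp, hpN⟩ := Nat.exists_prime_and_dvd hN1
  obtain ⟨q, hq, hqN, hqp⟩ : ∃ q, q.Prime ∧ q ∣ Nat.card N ∧ q ≠ p := by
    by_contra hcon
    push Not at hcon
    exact hpp (isPrimePow_iff_unique_prime_dvd.2 ⟨p, ⟨hp, hpN⟩, fun q hq => hcon q hq.1 hq.2⟩)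
  set a := ordProj[p] (Nat.card G) with ha
  set b := ordCompl[p] (Nat.card G) with hb
  have hG : Nat.card G ≠ 0 := Nat.card_pos.ne'
  have hcard : a * b = Nat.card G := Nat.ordProj_mul_ordCompl_eq_self _ _
  have hab : a.Coprime b := (Nat.coprime_ordCompl hp hG).pow_left _
  have hpa : p ∣ a := by
    have hpG : p ∣ Nat.card G := hpN.trans N.card_subgroup_dvd_card
    exact dvd_pow_self p (hp.factorization_pos_of_dvd hG hpG).ne'
  have hqb : q ∣ b := by
    have hqG : q ∣ a * b := hcard ▸ hqN.trans N.card_subgroup_dvd_card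
    refine (hq.dvd_mul.1 hqG).resolve_left fun hqa => hqp ?_
    exact (Nat.prime_dvd_prime_iff_eq hq hp).1 (hq.dvd_of_dvd_pow hqa)
  have hflat : ∀ x ∈ N, IsFlat x := fun x hx => isFlat_of_mem h hx
  have hex : ∀ {r c : ℕ}, r.Prime → r ∣ Nat.card N → r ∣ c → ∃ x ∈ N, x ≠ 1 ∧ x ^ c = 1 := by
    intro r c hr hrN hrc
    have := Fact.mk hr
    obtain ⟨x, hx⟩ := exists_prime_orderOf_dvd_card' r hrN
    refine ⟨x, x.2, fun h1 => ?_, ?_⟩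
    · rw [OneMemClass.coe_eq_one.1 h1, orderOf_one] at hx
      exact hr.one_lt.ne hx
    · have h1 : x ^ c = 1 := orderOf_dvd_iff_pow_eq_one.1 (hx ▸ hrc)
      exact_mod_cast congrArg Subtype.val h1
  obtain ⟨z, hz, hz1, hza, hzc⟩ := exists_central_pow_eq_one hab hcard
    (fun x hx _ => hflat x hx) (fun x hx _ => hflat x hx) (hex hp hpN hpa)
  obtain ⟨w, hw, hw1, hwb, hwc⟩ := exists_central_pow_eq_one hab.symm (by rw [mul_comm, hcard])
    (fun x hx _ => hflat x hx) (fun x hx _ => hflat x hx) (hex hq hqN hqb)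
  -- If `x` were conjugate to `x * w`, the central `w` would be both `a`- and `b`-torsion.
  have hA : ∀ x : G, x ^ a = 1 → IsFlat x := fun x hx =>
    isFlat_of_not_isConj_mul h hw fun hc =>
      hw1 (eq_one_of_coprime_pow hab (pow_eq_one_of_isConj_mul (hwc x).symm hc hx) hwb)
  have hB : ∀ x : G, x ^ b = 1 → IsFlat x := fun x hx =>
    isFlat_of_not_isConj_mul h hz fun hc =>
      hz1 (eq_one_of_coprime_pow hab hza (pow_eq_one_of_isConj_mul (hzc x).symm hc hx))
  exact fun χ hχ g hg => char_eq_zero_of_isFlat (isFlat_of_forall_isFlat hab hcard hA hB g) hχ hg
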